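/- For $m\ge 1$ let $K_m$ be the complete directed graph with self-loops on $V=\{1,\dots,m\}$, with edge set $V\times V$. A spanning unicycle of $K_m$ is a map $\rho:V\to V$ such that the directed graph with edges $(x,\rho(x))$, $x\in V$, contains exactly one directed cycle (a loop counts as a cycle). Let $\mathsf U_m$ be the set of pairs $(x,\rho)$ where $\rho$ is a spanning unicycle of $K_m$ and $x\in V$ lies on its unique cycle. The unicycle graph is the directed graph on $\mathsf U_m$ with an edge from $(x,\rho)$ to $(y,\eta)$ whenever $\eta(z)=\rho(z)$ for all $z\neq x$ and $\eta(x)=y$. The uniform unicycle walk on $K_m$ is the simple random walk on the unicycle graph, which moves at each step to a uniformly chosen out-neighbour of the current state. Denote its transition matrix by $P_m$. Then, for every $m\ge1$, $P_m$ has a unique stationary probability distribution $\mu^{(m)}$ on $\mathsf U_m$, and for every $\varepsilon>0$ the mixing time $$t^{(m)}_{\mathrm{mix}}(\varepsilon)=\min\Big\{t\in\{0,1,2,\dots\}:\ \max_{(x,\rho)\in\mathsf U_m}\big\|P_m^{t}\big((x,\rho),\cdot\big)-\mu^{(m)}\big\|_{TV}<\varepsilon\Big\}$$ is finite, where $\|\nu-\mu\|_{TV}=\frac12\sum_{s}|\nu(s)-\mu(s)|$.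 The walk exhibits cutoff at time $m\log m$: for every $\varepsilon\in(0,1)$, $$\lim_{m\to\infty}\frac{t^{(m)}_{\mathrm{mix}}(\varepsilon)}{m\log m}=1\qquad\text{and}\qquad \lim_{m\to\infty}\frac{t^{(m)}_{\mathrm{mix}}(\varepsilon)}{t^{(m)}_{\mathrm{mix}}(1-\varepsilon)}=1 .$$ -/

import Mathlib

open Filter Topology

/-- The vertex set `C` of a directed cycle in the directed graph with edges `(x, ρ x)`. Every
vertex has out-degree one there, so the directed cycles (loops included) are exactly the forward
orbits of the periodic points of `ρ`. -/
def IsDirectedCycle {V : Type*} (ρ : V → V) (C : Set V) : Prop :=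
  ∃ x ∈ Function.periodicPts ρ, C = {y | ∃ n : ℕ, ρ^[n] x = y}

/-- The configuration `ρ` is a spanning unicycle of `G`: its edges `(x, ρ x)` are edges of `G`,
they contain exactly one directed cycle, and from every vertex there is a path to this cycle
(necessarily unique, since every vertex has out-degree one). -/
def IsSpanningUnicycle {V : Type*} (G : Digraph V) (ρ : V → V) : Prop :=
  (∀ x, G.Adj x (ρ x)) ∧
    ∃ C : Set V, IsDirectedCycle ρ C ∧ (∀ C' : Set V, IsDirectedCycle ρ C' → C' = C) ∧
      ∀ x, ∃ n : ℕ, ρ^[n] x ∈ C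

/-- The set `U_G` of pairs `(x, ρ)` of a particle location `x` and a spanning unicycle `ρ` of `G`
such that `x` lies on the unique directed cycle of `ρ`. -/
def UnicycleState {V : Type*} (G : Digraph V) : Type _ :=
  {s : V × (V → V) // IsSpanningUnicycle G s.2 ∧ ∃ C, IsDirectedCycle s.2 C ∧ s.1 ∈ C}

namespace UnicycleState

variable {V : Type*} {G : Digraph V}

/-- The location of the particle. -/
def loc (s : UnicycleState G) : V := s.1.1

/-- The configuration of last exits. -/
def conf (s : UnicycleState G) : V → V := s.1.2

end UnicycleState

noncomputable instance {V : Type*} [Finite V] (G : Digraph V) : Fintype (UnicycleState G) :=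
  have : Finite (UnicycleState G) :=
    inferInstanceAs (Finite {s : V × (V → V) //
      IsSpanningUnicycle G s.2 ∧ ∃ C, IsDirectedCycle s.2 C ∧ s.1 ∈ C})
  Fintype.ofFinite _

noncomputable instance {V : Type*} (G : Digraph V) : DecidableEq (UnicycleState G) :=
  Classical.decEq _

/-- The unicycle graph `UCYC(G)`: there is an edge from `(x, ρ)` to `(y, η)` if `(x, y)` is an edge
of `G`, `ρ` and `η` agree everywhere except possibly at `x`, and `η x = y`. -/
def unicycleGraph {V : Type*} (G : Digraph V) : Digraph (UnicycleState G) where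
  Adj s s' := G.Adj s.loc s'.loc ∧ (∀ z, z ≠ s.loc → s'.conf z = s.conf z) ∧
    s'.conf s.loc = s'.loc

open Classical in
/-- The transition matrix of the simple random walk on a finite directed graph `D`: from `s` the
walk moves to a uniformly chosen out-neighbour of `s`. -/
noncomputable def simpleRandomWalk {S : Type*} [Fintype S] (D : Digraph S) : Matrix S S ℝ :=
  fun s s' => if D.Adj s s' then ((Finset.univ.filter fun r => D.Adj s r).card : ℝ)⁻¹ else 0

/-- The transition matrix of the uniform unicycle walk on `G`. -/
noncomputable def uniformUnicycleWalk {V : Type*} [Finite V] (G : Digraph V) :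
    Matrix (UnicycleState G) (UnicycleState G) ℝ :=
  simpleRandomWalk (unicycleGraph G)

/-- The complete graph on `m` vertices, with a loop at every vertex: the edges are all ordered
pairs `(i, j)`. -/
def loopedComplete (m : ℕ) : Digraph (Fin m) where
  Adj _ _ := True

/-- `μ` is a stationary probability distribution of the Markov chain with transition matrix `P`. -/
def IsStationaryDistribution {S : Type*} [Fintype S] (P : Matrix S S ℝ) (μ : S → ℝ) : Prop :=
  (∀ s, 0 ≤ μ s) ∧ ∑ s, μ s = 1 ∧ Matrix.vecMul μ P = μ

/-- Total variation distance of two distributions on a finite set. -/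
noncomputable def tvDist {S : Type*} [Fintype S] (ν μ : S → ℝ) : ℝ :=
  (1 / 2) * ∑ s, |ν s - μ s|

/-- The worst-case distance `d(t)` to `μ` after `t` steps of the chain with transition matrix `P`;
the law at time `t` from `s` is the row `s` of `P ^ t`. -/
noncomputable def worstDist {S : Type*} [Fintype S] [DecidableEq S] (P : Matrix S S ℝ) (μ : S → ℝ)
    (t : ℕ) : ℝ :=
  ⨆ s : S, tvDist ((P ^ t) s) μ

/-- The mixing time `min {t : d(t) < ε}`. -/
noncomputable def mixingTime {S : Type*} [Fintype S] [DecidableEq S] (P : Matrix S S ℝ)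
    (μ : S → ℝ) (ε : ℝ) : ℕ :=
  sInf {t : ℕ | worstDist P μ t < ε}

/-!
The uniform unicycle walk on the looped complete graph moves the particle from `x` to a uniform
vertex `y` and redirects the out-edge of `x` to `y` (`isRandomMapRep_uniformUnicycleWalk`): deleting
the out-edge of `x` from a unicycle through `x` leaves a spanning tree rooted at `x`, and adding any
edge `(x, y)` to this tree gives a unicycle through `y`. So the particle performs independent
uniform draws, and the mixing time is governed by the coupon collector problem.

*Upper bound.* Run the walk from all starting states with the same draws. As soon as every vertex
has been drawn, one more step makes all copies agree (`runMaps_unicycleStep_eq`), since the out-edge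
of a vertex points to where the particle went when it last left that vertex. Hence the distance to
stationarity at time `n + 1` is at most `m (1 - 1 / m) ^ n` (`worstDist_succ_le`), which tends to
zero for `n = (1 + δ) m log m`. The same coupling gives uniqueness of the stationary distribution;
existence holds for every stochastic matrix (`exists_isStationaryDistribution`).

*Lower bound.* All `m` edges of a configuration point somewhere, so under the stationary
distribution some vertex `v` has mean in-degree at most one. Start the walk from the star at `v`. At
time `n` every unvisited vertex still points to `v`, and by Chebyshev's inequality
(`card_missed_lt_le`) the number of these is likely to be at least half its mean
`a = (m - 1) (1 - 1 / m) ^ n`. By Markov's inequality so large an in-degree is unlikely under the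
stationary distribution, and the distance is at least `1 - 6 / a` (`one_sub_le_worstDist`). For
`n ≤ (1 - δ) m log m` the mean `a` tends to infinity.
-/

/-! ### Chains given by uniformly random maps -/

lemma sum_fin_succ_eq_sum_snoc {V : Type*} [Fintype V] {n : ℕ} (g : (Fin (n + 1) → V) → ℝ) :
    ∑ ω, g ω = ∑ ω : Fin n → V, ∑ y, g (Fin.snoc ω y) := by
  rw [← (Fin.snocEquiv (fun _ : Fin (n + 1) => V)).sum_comp, Fintype.sum_prod_type_right]
  rfl

section RandomMap

variable {S V : Type*} [Fintype S] [DecidableEq S] [Fintype V]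

/-- The chain with transition matrix `P` moves from `s` to `f s y` with `y : V` uniform. -/
def IsRandomMapRep (P : Matrix S S ℝ) (f : S → V → S) : Prop :=
  ∀ s s', P s s' = (Fintype.card V : ℝ)⁻¹ * ∑ y, if f s y = s' then 1 else 0

/-- The state reached from `s` when the maps `f · (ω 0)`, …, `f · (ω (n - 1))` are applied in this
order. -/
def runMaps (f : S → V → S) : (n : ℕ) → S → (Fin n → V) → S
  | 0, s, _ => s
  | n + 1, s, ω => f (runMaps f n s (Fin.init ω)) (ω (Fin.last n))

variable {P : Matrix S S ℝ} {f : S → V → S}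

lemma IsRandomMapRep.pow_apply (h : IsRandomMapRep P f) (n : ℕ) (s u : S) :
    (P ^ n) s u =
      ((Fintype.card V : ℝ) ^ n)⁻¹ * ∑ ω, if runMaps f n s ω = u then 1 else 0 := by
  induction n generalizing u with
  | zero =>
    rw [pow_zero, Matrix.one_apply, Fintype.sum_eq_single (Fin.elim0 ·) fun ω hω =>
      (hω (Subsingleton.elim _ _)).elim]
    by_cases h : s = u <;> simp [h, runMaps]
  | succ n ih =>
    rw [pow_succ, Matrix.mul_apply, sum_fin_succ_eq_sum_snoc]
    simp only [ih, h _ u, runMaps, Fin.init_snoc, Fin.snoc_last]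
    simp only [Finset.mul_sum, Finset.sum_mul]
    rw [Finset.sum_congr rfl fun _ _ => Finset.sum_comm, Finset.sum_comm]
    refine Finset.sum_congr rfl fun ω _ => ?_
    rw [Finset.sum_comm]
    refine Finset.sum_congr rfl fun y _ => ?_
    rw [Finset.sum_eq_single (runMaps f n s ω)]
    · simp [pow_succ, mul_comm]
    · intro b _ hb
      simp [hb.symm]
    · simp

lemma IsRandomMapRep.sum_pow_mul (h : IsRandomMapRep P f) (n : ℕ) (s : S) (g : S → ℝ) :
    ∑ u, (P ^ n) s u * g u =
      ((Fintype.card V : ℝ) ^ n)⁻¹ * ∑ ω, g (runMaps f n s ω) := by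
  simp only [h.pow_apply, mul_assoc, Finset.sum_mul, ← Finset.mul_sum]
  rw [Finset.sum_comm]
  simp

lemma IsRandomMapRep.row_sum [Nonempty V] (h : IsRandomMapRep P f) (n : ℕ) (s : S) :
    ∑ u, (P ^ n) s u = 1 := by
  have := h.sum_pow_mul n s (fun _ => 1)
  simpa using this

lemma IsRandomMapRep.pow_nonneg (h : IsRandomMapRep P f) (n : ℕ) (s u : S) :
    0 ≤ (P ^ n) s u := by
  rw [h.pow_apply]
  exact mul_nonneg (by positivity) (Finset.sum_nonneg fun _ _ => by split_ifs <;> simp)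

/-- Grand coupling: outside the set `B` of choices the random map forgets its starting point, so a
signed measure of total mass zero is annihilated there. -/
lemma IsRandomMapRep.sum_abs_vecMul_pow_le (h : IsRandomMapRep P f) (n : ℕ)
    (B : Finset (Fin n → V))
    (hB : ∀ ω, ω ∉ B → ∀ s s', runMaps f n s ω = runMaps f n s' ω)
    (w : S → ℝ) (hw : ∑ s, w s = 0) :
    ∑ u, |Matrix.vecMul w (P ^ n) u| ≤
      ((Fintype.card V : ℝ) ^ n)⁻¹ * B.card * ∑ s, |w s| := by
  classical
  have key : ∀ ω, ∑ u, |∑ s, w s * (if runMaps f n s ω = u then 1 else 0)| ≤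
      (if ω ∈ B then 1 else 0) * ∑ s, |w s| := by
    intro ω
    split_ifs with hω
    · calc _ ≤ ∑ u, ∑ s, |w s| * (if runMaps f n s ω = u then 1 else 0) := by
            refine Finset.sum_le_sum fun u _ => (Finset.abs_sum_le_sum_abs _ _).trans_eq ?_
            refine Finset.sum_congr rfl fun s _ => ?_
            split_ifs <;> simp
        _ = 1 * ∑ s, |w s| := by
            rw [Finset.sum_comm]
            simp
    · rw [zero_mul]
      refine le_of_eq (Finset.sum_eq_zero fun u _ => ?_)
      rcases isEmpty_or_nonempty S with hS | ⟨⟨s₀⟩⟩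
      · exact hS.elim u
      · simp only [hB ω hω _ s₀, ← Finset.sum_mul, hw, zero_mul, abs_zero]
  calc ∑ u, |Matrix.vecMul w (P ^ n) u|
      = ∑ u, ((Fintype.card V : ℝ) ^ n)⁻¹ *
          |∑ ω, ∑ s, w s * (if runMaps f n s ω = u then 1 else 0)| := by
        refine Finset.sum_congr rfl fun u _ => ?_
        have h0 : 0 ≤ ((Fintype.card V : ℝ) ^ n)⁻¹ := by positivity
        have hv : Matrix.vecMul w (P ^ n) u = ((Fintype.card V : ℝ) ^ n)⁻¹ *
            ∑ ω, ∑ s, w s * (if runMaps f n s ω = u then 1 else 0) := by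
          simp only [Matrix.vecMul, dotProduct, h.pow_apply]
          rw [Finset.sum_comm, Finset.mul_sum]
          refine Finset.sum_congr rfl fun s _ => ?_
          rw [← Finset.mul_sum]
          ring
        rw [hv, abs_mul, abs_of_nonneg h0]
    _ ≤ ∑ u, ((Fintype.card V : ℝ) ^ n)⁻¹ *
          ∑ ω, |∑ s, w s * (if runMaps f n s ω = u then 1 else 0)| := by
        gcongr
        exact Finset.abs_sum_le_sum_abs _ _
    _ = ((Fintype.card V : ℝ) ^ n)⁻¹ *
          ∑ ω, ∑ u, |∑ s, w s * (if runMaps f n s ω = u then 1 else 0)| := by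
        rw [← Finset.mul_sum, Finset.sum_comm]
    _ ≤ ((Fintype.card V : ℝ) ^ n)⁻¹ * ∑ ω, (if ω ∈ B then 1 else 0) * ∑ s, |w s| := by
        gcongr with ω
        exact key ω
    _ = _ := by
        rw [← Finset.sum_mul]
        simp [mul_assoc]

end RandomMap

/-! ### Stationary distributions and total variation -/

section Stationary

variable {S : Type*} [Fintype S]

/-- If `w P = w` then `|w| ≤ |w| P` entrywise; both sides have the same sum, so `|w|` is again
invariant. -/
lemma exists_isStationaryDistribution [Nonempty S] (P : Matrix S S ℝ) (h0 : ∀ s u, 0 ≤ P s u)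
    (h1 : ∀ s, ∑ u, P s u = 1) : ∃ μ, IsStationaryDistribution P μ := by
  classical
  -- `1 - P` annihilates the constant column vector, hence also some row vector.
  have hdet : (1 - P).det = 0 := by
    rw [← Matrix.exists_mulVec_eq_zero_iff]
    refine ⟨fun _ => 1, fun h => one_ne_zero (congrFun h (Classical.arbitrary S)), ?_⟩
    ext s
    rw [Matrix.sub_mulVec, Matrix.one_mulVec]
    simp [Matrix.mulVec, dotProduct, h1]
  obtain ⟨w, hw0, hw⟩ := Matrix.exists_vecMul_eq_zero_iff.2 hdet
  rw [Matrix.vecMul_sub, Matrix.vecMul_one, sub_eq_zero] at hw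
  have hle : ∀ u, |w u| ≤ Matrix.vecMul (fun s => |w s|) P u := by
    intro u
    conv_lhs => rw [hw]
    refine (Finset.abs_sum_le_sum_abs _ _).trans_eq ?_
    refine Finset.sum_congr rfl fun s _ => ?_
    rw [abs_mul, abs_of_nonneg (h0 s u)]
  have hsum : ∑ u, |w u| = ∑ u, Matrix.vecMul (fun s => |w s|) P u := by
    simp only [Matrix.vecMul, dotProduct]
    rw [Finset.sum_comm]
    simp [← Finset.mul_sum, h1]
  have heq : Matrix.vecMul (fun s => |w s|) P = fun s => |w s| := by
    ext u
    exact (((Finset.sum_eq_sum_iff_of_le fun u _ => hle u).1 hsum) u (Finset.mem_univ u)).symm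
  have hpos : 0 < ∑ s, |w s| := by
    obtain ⟨s, hs⟩ := Function.ne_iff.1 hw0
    exact Finset.sum_pos' (fun _ _ => abs_nonneg _) ⟨s, Finset.mem_univ s, abs_pos.2 hs⟩
  refine ⟨(∑ s, |w s|)⁻¹ • fun s => |w s|, fun s => ?_, ?_, ?_⟩
  · exact mul_nonneg (inv_nonneg.2 hpos.le) (abs_nonneg _)
  · simp only [Pi.smul_apply, smul_eq_mul, ← Finset.mul_sum]
    exact inv_mul_cancel₀ hpos.ne'
  · rw [Matrix.smul_vecMul, heq]

lemma IsStationaryDistribution.vecMul_pow [DecidableEq S] {P : Matrix S S ℝ} {μ : S → ℝ}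
    (h : IsStationaryDistribution P μ) (n : ℕ) : Matrix.vecMul μ (P ^ n) = μ := by
  induction n with
  | zero => simp
  | succ n ih => rw [pow_succ, ← Matrix.vecMul_vecMul, ih, h.2.2]

lemma sum_sub_sum_le_tvDist {p q : S → ℝ} (hp : ∑ s, p s = 1) (hq : ∑ s, q s = 1)
    (A : Finset S) : ∑ s ∈ A, p s - ∑ s ∈ A, q s ≤ tvDist p q := by
  classical
  have h1 : ∑ s ∈ A, (p s - q s) + ∑ s ∈ Aᶜ, (p s - q s) = 0 := by
    rw [Finset.sum_add_sum_compl, Finset.sum_sub_distrib, hp, hq, sub_self]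
  have h2 : ∑ s ∈ A, |p s - q s| + ∑ s ∈ Aᶜ, |p s - q s| = ∑ s, |p s - q s| :=
    Finset.sum_add_sum_compl _ _
  have h3 : ∑ s ∈ A, (p s - q s) ≤ ∑ s ∈ A, |p s - q s| :=
    Finset.sum_le_sum fun s _ => le_abs_self _
  have h4 : -∑ s ∈ Aᶜ, (p s - q s) ≤ ∑ s ∈ Aᶜ, |p s - q s| := by
    rw [← Finset.sum_neg_distrib]
    exact Finset.sum_le_sum fun s _ => neg_le_abs _
  rw [Finset.sum_sub_distrib] at h1 h3
  unfold tvDist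
  linarith

lemma tvDist_le_worstDist [DecidableEq S] (P : Matrix S S ℝ) (μ : S → ℝ) (t : ℕ) (s : S) :
    tvDist ((P ^ t) s) μ ≤ worstDist P μ t :=
  le_ciSup (f := fun s => tvDist ((P ^ t) s) μ) (Set.finite_range _).bddAbove s

variable {V : Type*} [Fintype V] {P : Matrix S S ℝ} {f : S → V → S}

lemma IsRandomMapRep.worstDist_le [DecidableEq S] [Nonempty S] (h : IsRandomMapRep P f) (n : ℕ)
    (B : Finset (Fin n → V))
    (hB : ∀ ω, ω ∉ B → ∀ s s', runMaps f n s ω = runMaps f n s' ω)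
    {μ : S → ℝ} (hμ : IsStationaryDistribution P μ) :
    worstDist P μ n ≤ ((Fintype.card V : ℝ) ^ n)⁻¹ * B.card := by
  refine ciSup_le fun s => ?_
  have hw : ∑ u, (Pi.single (M := fun _ => ℝ) s 1 - μ) u = 0 := by
    simp [Finset.sum_sub_distrib, hμ.2.1]
  have h1 := h.sum_abs_vecMul_pow_le n B hB _ hw
  have h2 : Matrix.vecMul (Pi.single (M := fun _ => ℝ) s 1 - μ) (P ^ n) = (P ^ n) s - μ := by
    rw [Matrix.sub_vecMul, hμ.vecMul_pow, Matrix.single_one_vecMul]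
    rfl
  have h3 : ∑ u, |(Pi.single (M := fun _ => ℝ) s 1 - μ) u| ≤ 2 := by
    calc _ ≤ ∑ u, (Pi.single (M := fun _ => ℝ) s 1 u + μ u) := by
          refine Finset.sum_le_sum fun u _ => ?_
          have h5 : 0 ≤ Pi.single (M := fun _ => ℝ) s (1 : ℝ) u := by
            rw [Pi.single_apply]; split_ifs <;> simp
          have := hμ.1 u
          rw [Pi.sub_apply, abs_le]
          constructor <;> linarith
      _ = 2 := by
          rw [Finset.sum_add_distrib, hμ.2.1]
          rw [Finset.univ.sum_pi_single']
          norm_num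
  rw [h2] at h1
  have h4 := h1.trans (mul_le_mul_of_nonneg_left h3 (by positivity))
  simp only [Pi.sub_apply] at h4
  unfold tvDist
  linarith

lemma IsRandomMapRep.isStationaryDistribution_unique [DecidableEq S] (h : IsRandomMapRep P f)
    (n : ℕ) (B : Finset (Fin n → V))
    (hB : ∀ ω, ω ∉ B → ∀ s s', runMaps f n s ω = runMaps f n s' ω)
    (hlt : ((Fintype.card V : ℝ) ^ n)⁻¹ * B.card < 1)
    {μ ν : S → ℝ} (hμ : IsStationaryDistribution P μ) (hν : IsStationaryDistribution P ν) :
    μ = ν := by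
  have hw : ∑ u, (μ - ν) u = 0 := by
    simp [Finset.sum_sub_distrib, hμ.2.1, hν.2.1]
  have h1 := h.sum_abs_vecMul_pow_le n B hB _ hw
  rw [Matrix.sub_vecMul, hμ.vecMul_pow, hν.vecMul_pow] at h1
  have h0 : 0 ≤ ∑ u, |(μ - ν) u| := Finset.sum_nonneg fun _ _ => abs_nonneg _
  have h2 : ∑ u, |(μ - ν) u| = 0 := by nlinarith
  ext u
  have := (Finset.sum_eq_zero_iff_of_nonneg fun _ _ => abs_nonneg _).1 h2 u (Finset.mem_univ u)
  simpa [sub_eq_zero] using this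

end Stationary

/-! ### Coupon collecting -/

section Coupons

variable {V : Type*} [Fintype V] [DecidableEq V]

lemma sum_indicator_avoid (n : ℕ) (A : Finset V) :
    ∑ ω : Fin n → V, (if ∀ i, ω i ∉ A then (1 : ℝ) else 0) =
      ((Fintype.card V : ℝ) - A.card) ^ n := by
  rw [Finset.sum_boole]
  have : (Finset.univ.filter fun ω : Fin n → V => ∀ i, ω i ∉ A) =
      Fintype.piFinset fun _ => Aᶜ := by
    ext ω
    simp [Fintype.mem_piFinset]
  rw [this, Fintype.card_piFinset_const, Finset.card_compl, Nat.cast_pow,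
    Nat.cast_sub (Finset.card_le_univ A)]

/-- The words of length `n + 1` whose first `n` letters do not exhaust the alphabet. -/
def missingWords (V : Type*) [Fintype V] [DecidableEq V] (n : ℕ) : Finset (Fin (n + 1) → V) :=
  Finset.univ.filter fun ω => ∃ z, ∀ i, Fin.init ω i ≠ z

/-- Union bound over the missed letter. -/
lemma card_missingWords_le (n : ℕ) :
    ((missingWords V n).card : ℝ) ≤
      Fintype.card V * (Fintype.card V * ((Fintype.card V : ℝ) - 1) ^ n) := by
  rw [missingWords, ← Finset.sum_boole, sum_fin_succ_eq_sum_snoc]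
  simp only [Fin.init_snoc, Finset.sum_const, Finset.card_univ, nsmul_eq_mul, ← Finset.mul_sum]
  gcongr
  calc ∑ ω : Fin n → V, (if ∃ z, ∀ i, ω i ≠ z then (1 : ℝ) else 0)
      ≤ ∑ ω : Fin n → V, ∑ z, (if ∀ i, ω i ∉ ({z} : Finset V) then (1 : ℝ) else 0) := by
        refine Finset.sum_le_sum fun ω _ => ?_
        have hnn : ∀ z ∈ (Finset.univ : Finset V),
            (0 : ℝ) ≤ if ∀ i, ω i ∉ ({z} : Finset V) then (1 : ℝ) else 0 :=
          fun z _ => by split_ifs <;> simp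
        split_ifs with h
        · obtain ⟨z, hz⟩ := h
          refine le_trans ?_ (Finset.single_le_sum hnn (Finset.mem_univ z))
          simp [hz]
        · exact Finset.sum_nonneg hnn
    _ = _ := by
        rw [Finset.sum_comm]
        simp only [sum_indicator_avoid]
        simp

/-- The number of letters other than `v` that a word misses. -/
def missed (v : V) {n : ℕ} (ω : Fin n → V) : ℕ :=
  (Finset.univ.filter fun z => z ≠ v ∧ ∀ i, ω i ≠ z).card

lemma missed_eq_sum (v : V) {n : ℕ} (ω : Fin n → V) :
    (missed v ω : ℝ) = ∑ z ∈ Finset.univ.erase v, if ∀ i, ω i ∉ ({z} : Finset V) then 1 else 0 := by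
  rw [Finset.sum_boole, missed]
  congr 2
  ext z
  simp

lemma sum_missed (v : V) (n : ℕ) :
    ∑ ω : Fin n → V, (missed v ω : ℝ) =
      ((Fintype.card V : ℝ) - 1) * ((Fintype.card V : ℝ) - 1) ^ n := by
  simp only [missed_eq_sum]
  rw [Finset.sum_comm]
  simp only [sum_indicator_avoid, Finset.sum_const, Finset.card_erase_of_mem (Finset.mem_univ v),
    Finset.card_univ, Finset.card_singleton, nsmul_eq_mul]
  rw [Nat.cast_sub (Fintype.card_pos_iff.2 ⟨v⟩)]
  simp

lemma sum_missed_sq (v : V) (n : ℕ) :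
    ∑ ω : Fin n → V, (missed v ω : ℝ) ^ 2 =
      ((Fintype.card V : ℝ) - 1) * ((Fintype.card V : ℝ) - 1) ^ n +
      ((Fintype.card V : ℝ) - 1) * ((Fintype.card V : ℝ) - 2) *
        ((Fintype.card V : ℝ) - 2) ^ n := by
  have hc : (((Finset.univ.erase v).card : ℕ) : ℝ) = (Fintype.card V : ℝ) - 1 := by
    rw [Finset.card_erase_of_mem (Finset.mem_univ v), Finset.card_univ,
      Nat.cast_sub (Fintype.card_pos_iff.2 ⟨v⟩), Nat.cast_one]
  have h1 : ∀ ω : Fin n → V, (missed v ω : ℝ) ^ 2 =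
      ∑ z ∈ Finset.univ.erase v, ∑ z' ∈ Finset.univ.erase v,
        if ∀ i, ω i ∉ ({z, z'} : Finset V) then (1 : ℝ) else 0 := by
    intro ω
    rw [sq, missed_eq_sum, Finset.sum_mul_sum]
    refine Finset.sum_congr rfl fun z _ => Finset.sum_congr rfl fun z' _ => ?_
    rw [ite_zero_mul_ite_zero, mul_one]
    congr 1
    simp [forall_and]
  simp only [h1]
  rw [Finset.sum_comm]
  have h2 : ∀ z ∈ Finset.univ.erase v,
      ∑ ω : Fin n → V, ∑ z' ∈ Finset.univ.erase v,
        (if ∀ i, ω i ∉ ({z, z'} : Finset V) then (1 : ℝ) else 0) =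
      ((Fintype.card V : ℝ) - 1) ^ n +
        ((Fintype.card V : ℝ) - 2) * ((Fintype.card V : ℝ) - 2) ^ n := by
    intro z hz
    rw [Finset.sum_comm]
    simp only [sum_indicator_avoid]
    rw [← Finset.add_sum_erase _ _ hz]
    congr 1
    · simp
    · rw [Finset.sum_congr rfl (g := fun _ => ((Fintype.card V : ℝ) - 2) ^ n), Finset.sum_const,
        nsmul_eq_mul, Finset.card_erase_of_mem hz,
        Nat.cast_sub (Finset.card_pos.2 ⟨z, hz⟩), hc]
      · push_cast; ring
      · intro z' hz'
        rw [Finset.card_pair (Finset.ne_of_mem_erase hz').symm]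
        norm_num
  rw [Finset.sum_congr rfl h2, Finset.sum_const, nsmul_eq_mul, hc]
  ring

/-- Chebyshev's inequality: the events of missing two given letters are negatively correlated, so
the variance of the number of missed letters is at most its mean `a`. -/
lemma card_missed_lt_le (v : V) (n : ℕ) (hV : 2 ≤ Fintype.card V) {a : ℝ}
    (ha : a = ((Fintype.card V : ℝ) - 1) *
      (((Fintype.card V : ℝ) - 1) / Fintype.card V) ^ n) :
    ((Fintype.card V : ℝ) ^ n)⁻¹ *
      ((Finset.univ.filter fun ω : Fin n → V => (missed v ω : ℝ) < a / 2).card : ℝ) ≤ 4 / a := by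
  set c : ℝ := (Fintype.card V : ℝ) with hc
  have hc2 : (2 : ℝ) ≤ c := by
    rw [hc]
    exact_mod_cast hV
  have hcn : 0 < c ^ n := by positivity
  have hc1 : 0 < c - 1 := by linarith
  have ha0 : 0 < a := by rw [ha]; positivity
  have hca : (c - 1) * (c - 1) ^ n = a * c ^ n := by
    rw [ha, div_pow]; field_simp
  -- The mean of `missed v` is `a`, and `(c - 2) * c ≤ (c - 1) ^ 2` bounds the second moment by
  -- `a + a ^ 2`.
  have hvar : ∑ ω : Fin n → V, ((missed v ω : ℝ) - a) ^ 2 ≤ a * c ^ n := by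
    have h2 : (c - 1) * (c - 2) * (c - 2) ^ n ≤ a ^ 2 * c ^ n := by
      have h3 : (c - 2) ^ n * c ^ n ≤ (c - 1) ^ n * (c - 1) ^ n := by
        rw [← mul_pow, ← mul_pow]
        exact pow_le_pow_left₀ (by nlinarith) (by nlinarith) n
      have h4 : (c - 1) * (c - 2) * (c - 2) ^ n * c ^ n ≤ a ^ 2 * c ^ n * c ^ n := by
        calc (c - 1) * (c - 2) * (c - 2) ^ n * c ^ n
            = ((c - 1) * (c - 2)) * ((c - 2) ^ n * c ^ n) := by ring
          _ ≤ ((c - 1) * (c - 1)) * ((c - 1) ^ n * (c - 1) ^ n) := by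
              apply mul_le_mul _ h3
              · exact mul_nonneg (pow_nonneg (by linarith) n) hcn.le
              · nlinarith
              · nlinarith
          _ = ((c - 1) * (c - 1) ^ n) * ((c - 1) * (c - 1) ^ n) := by ring
          _ = _ := by rw [hca]; ring
      exact le_of_mul_le_mul_right h4 hcn
    have hexp : ∑ ω : Fin n → V, ((missed v ω : ℝ) - a) ^ 2 =
        ∑ ω : Fin n → V, (missed v ω : ℝ) ^ 2 - 2 * a * ∑ ω : Fin n → V, (missed v ω : ℝ)
          + a ^ 2 * c ^ n := by
      have : ∑ _ω : Fin n → V, a ^ 2 = a ^ 2 * c ^ n := by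
        simp [hc, mul_comm]
      rw [← this, Finset.mul_sum, ← Finset.sum_sub_distrib, ← Finset.sum_add_distrib]
      exact Finset.sum_congr rfl fun ω _ => by ring
    rw [hexp, sum_missed, sum_missed_sq, ← hc, hca]
    nlinarith
  have hcheb : ((Finset.univ.filter fun ω : Fin n → V => (missed v ω : ℝ) < a / 2).card : ℝ) *
      (a / 2) ^ 2 ≤ a * c ^ n := by
    refine le_trans ?_ hvar
    rw [← nsmul_eq_mul, ← Finset.sum_const]
    refine (Finset.sum_le_sum fun ω hω => ?_).trans
      (Finset.sum_le_sum_of_subset_of_nonneg (Finset.filter_subset _ _) fun _ _ _ => sq_nonneg _)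
    have := (Finset.mem_filter.1 hω).2
    nlinarith
  rw [inv_mul_le_iff₀ hcn, mul_div_assoc', le_div_iff₀ ha0]
  nlinarith

end Coupons

/-! ### The step of the walk -/

/-- Redirecting the out-edge of `x` does not affect paths up to their first visit to `x`. -/
lemma reaches_of_update {V : Type*} [DecidableEq V] {ρ : V → V} {x : V} (y : V) (n : ℕ) (z : V)
    (h : ρ^[n] z = x) : ∃ k, (Function.update ρ x y)^[k] z = x := by
  induction n generalizing z with
  | zero => exact ⟨0, h⟩
  | succ n ih =>
    by_cases hz : z = x
    · exact ⟨0, hz⟩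
    · obtain ⟨k, hk⟩ := ih (ρ z) h
      exact ⟨k + 1, by rwa [Function.iterate_succ_apply, Function.update_of_ne hz]⟩

section Walk

variable {m : ℕ}

/-- A pair `(x, ρ)` is a unicycle state exactly when `x` can be reached from every vertex. -/
lemma isUnicycleState_iff (x : Fin m) (ρ : Fin m → Fin m) :
    (IsSpanningUnicycle (loopedComplete m) ρ ∧ ∃ C, IsDirectedCycle ρ C ∧ x ∈ C) ↔
      ∀ z, ∃ n : ℕ, ρ^[n] z = x := by
  constructor
  · rintro ⟨⟨-, C, -, huniq, hreach⟩, C', ⟨x₀, hx₀, hC'⟩, hxC'⟩ z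
    obtain rfl := huniq C' ⟨x₀, hx₀, hC'⟩
    subst hC'
    obtain ⟨b, hb⟩ := hxC'
    obtain ⟨n, a, ha⟩ := hreach z
    obtain ⟨p, hp, hper⟩ := hx₀
    -- From the point `ρ^[a] x₀` of the cycle, `p * a - a` further steps lead back to `x₀`.
    have hpa : ρ^[p * a] x₀ = x₀ := (hper.mul_const a).eq
    refine ⟨b + (p * a - a) + n, ?_⟩
    rw [Function.iterate_add_apply, ← ha, ← Function.iterate_add_apply,
      add_assoc, Nat.sub_add_cancel (Nat.le_mul_of_pos_left a hp), Function.iterate_add_apply,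
      hpa, hb]
  · intro h
    have hx : x ∈ Function.periodicPts ρ := by
      obtain ⟨n, hn⟩ := h (ρ x)
      exact ⟨n + 1, Nat.succ_pos n, hn⟩
    have hC : IsDirectedCycle ρ {y | ∃ n : ℕ, ρ^[n] x = y} := ⟨x, hx, rfl⟩
    have hmem : x ∈ {y | ∃ n : ℕ, ρ^[n] x = y} := ⟨0, rfl⟩
    refine ⟨⟨fun _ => trivial, _, hC, ?_, fun z => ?_⟩, _, hC, hmem⟩
    · rintro C' ⟨x', ⟨p, hp, hper⟩, rfl⟩
      obtain ⟨k, hk⟩ := h x'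
      ext y
      constructor
      · rintro ⟨n, rfl⟩
        refine ⟨n + (p * k - k), ?_⟩
        rw [← hk, ← Function.iterate_add_apply, add_assoc,
          Nat.sub_add_cancel (Nat.le_mul_of_pos_left k hp), Function.iterate_add_apply,
          (hper.mul_const k).eq]
      · rintro ⟨n, rfl⟩
        exact ⟨n + k, by rw [Function.iterate_add_apply, hk]⟩
    · obtain ⟨n, hn⟩ := h z
      exact ⟨n, by rw [hn]; exact hmem⟩

/-- A pair `(x, ρ)` in which `x` can be reached from every vertex, as a unicycle state. -/
def UnicycleState.ofReaches (x : Fin m) (ρ : Fin m → Fin m) (h : ∀ z, ∃ n : ℕ, ρ^[n] z = x) :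
    UnicycleState (loopedComplete m) :=
  ⟨(x, ρ), (isUnicycleState_iff x ρ).2 h⟩

lemma UnicycleState.reaches (s : UnicycleState (loopedComplete m)) (z : Fin m) :
    ∃ n : ℕ, s.conf^[n] z = s.loc :=
  (isUnicycleState_iff s.1.1 s.1.2).1 s.2 z

lemma UnicycleState.ext_loc_conf {s s' : UnicycleState (loopedComplete m)} (h : s.loc = s'.loc)
    (h' : s.conf = s'.conf) : s = s' :=
  Subtype.ext (Prod.ext h h')

/-- The particle moves from `x` to `y` and redirects the out-edge of `x` to `y`. Without its
out-edge, `x` is the root of a spanning tree, so every `y` is allowed. -/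
def unicycleStep (s : UnicycleState (loopedComplete m)) (y : Fin m) :
    UnicycleState (loopedComplete m) :=
  .ofReaches y (Function.update s.conf s.loc y) fun z => by
    obtain ⟨n, hn⟩ := s.reaches z
    obtain ⟨k, hk⟩ := reaches_of_update y n z hn
    exact ⟨k + 1, by rw [Function.iterate_succ_apply', hk, Function.update_self]⟩

@[simp] lemma unicycleStep_loc (s : UnicycleState (loopedComplete m)) (y : Fin m) :
    (unicycleStep s y).loc = y := rfl

@[simp] lemma unicycleStep_conf (s : UnicycleState (loopedComplete m)) (y : Fin m) :
    (unicycleStep s y).conf = Function.update s.conf s.loc y := rfl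

lemma unicycleGraph_adj_iff (s s' : UnicycleState (loopedComplete m)) :
    (unicycleGraph (loopedComplete m)).Adj s s' ↔ unicycleStep s s'.loc = s' := by
  constructor
  · rintro ⟨-, h1, h2⟩
    refine UnicycleState.ext_loc_conf rfl (funext fun z => ?_)
    by_cases hz : z = s.loc
    · subst hz
      simp [h2]
    · simp [hz, h1 z hz]
  · intro h
    rw [← h]
    exact ⟨trivial, fun z hz => by simp [hz], by simp⟩

/-- Every state has exactly `m` out-neighbours, one for each position of the particle. -/
lemma isRandomMapRep_uniformUnicycleWalk (m : ℕ) :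
    IsRandomMapRep (uniformUnicycleWalk (loopedComplete m)) (unicycleStep (m := m)) := by
  classical
  intro s s'
  have hinj : Function.Injective (unicycleStep s) := fun y y' h => by
    simpa using congrArg UnicycleState.loc h
  have hcard : (Finset.univ.filter fun r => (unicycleGraph (loopedComplete m)).Adj s r).card =
      Fintype.card (Fin m) := by
    rw [← Finset.card_univ, ← Finset.card_image_of_injective _ hinj]
    congr 1
    ext r
    simp only [Finset.mem_filter, Finset.mem_univ, true_and, Finset.mem_image,
      unicycleGraph_adj_iff]
    exact ⟨fun h => ⟨_, h⟩, fun ⟨y, hy⟩ => by rw [← hy, unicycleStep_loc]⟩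
  have hsum : (∑ y, if unicycleStep s y = s' then (1 : ℝ) else 0) =
      if unicycleStep s s'.loc = s' then 1 else 0 := by
    refine Finset.sum_eq_single _ (fun y _ hy => if_neg fun h => hy ?_) (by simp)
    rw [← h, unicycleStep_loc]
  rw [hsum, uniformUnicycleWalk, simpleRandomWalk]
  simp only [unicycleGraph_adj_iff] at hcard ⊢
  rw [hcard]
  simp

/-! ### Upper bound -/

/-- A vertex visited after time `0` has an out-edge that does not depend on the starting state,
except for the vertex currently occupied. -/
lemma runMaps_unicycleStep_agree (s s' : UnicycleState (loopedComplete m)) {n : ℕ}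
    (ω : Fin n → Fin m) (z : Fin m) (hz : ∃ i, ω i = z) :
    (runMaps unicycleStep n s ω).loc = (runMaps unicycleStep n s' ω).loc ∧
    ((runMaps unicycleStep n s ω).conf z = (runMaps unicycleStep n s' ω).conf z ∨
      (runMaps unicycleStep n s ω).loc = z) := by
  induction n with
  | zero => exact hz.choose.elim0
  | succ n ih =>
    refine ⟨rfl, ?_⟩
    obtain ⟨i, rfl⟩ := hz
    induction i using Fin.lastCases with
    | last => exact Or.inr rfl
    | cast j =>
      obtain ⟨h1, h2⟩ := ih (Fin.init ω) ⟨j, rfl⟩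
      left
      simp only [runMaps, unicycleStep_conf, Function.update_apply, ← h1]
      split_ifs with h
      · rfl
      · exact h2.resolve_right fun h3 => h h3.symm

/-- Once the first `n` moves visit every vertex, one more move leads to the same state from every
starting state. -/
lemma runMaps_unicycleStep_eq {n : ℕ} (ω : Fin (n + 1) → Fin m)
    (hω : ω ∉ missingWords (Fin m) n) (s s' : UnicycleState (loopedComplete m)) :
    runMaps unicycleStep (n + 1) s ω = runMaps unicycleStep (n + 1) s' ω := by
  have hcov : ∀ z, ∃ i, Fin.init ω i = z := by
    simpa [missingWords] using hω
  refine UnicycleState.ext_loc_conf rfl (funext fun z => ?_)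
  obtain ⟨h1, h2⟩ := runMaps_unicycleStep_agree s s' (Fin.init ω) z (hcov z)
  simp only [runMaps, unicycleStep_conf, Function.update_apply, ← h1]
  split_ifs with h
  · rfl
  · exact h2.resolve_right fun h3 => h h3.symm

lemma missing_fraction_le (hm : 1 ≤ m) (n : ℕ) :
    ((Fintype.card (Fin m) : ℝ) ^ (n + 1))⁻¹ * (missingWords (Fin m) n).card ≤
      m * ((m - 1) / m : ℝ) ^ n := by
  have h := card_missingWords_le (V := Fin m) n
  simp only [Fintype.card_fin] at h ⊢
  have hm0 : (0 : ℝ) < m := by exact_mod_cast hm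
  rw [inv_mul_le_iff₀ (by positivity)]
  refine h.trans_eq ?_
  rw [div_pow, pow_succ]
  field_simp

/-! ### Lower bound -/

/-- The configuration in which all edges point to `v`, with the particle at `v`. -/
def starState (v : Fin m) : UnicycleState (loopedComplete m) :=
  .ofReaches v (fun _ => v) fun _ => ⟨1, rfl⟩

/-- The out-edge of a vertex does not change as long as the vertex is not visited. -/
lemma runMaps_unicycleStep_conf_of_not_visited (s : UnicycleState (loopedComplete m)) {n : ℕ}
    (ω : Fin n → Fin m) (z : Fin m) (h0 : s.loc ≠ z) (hz : ∀ i, ω i ≠ z) :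
    (runMaps unicycleStep n s ω).loc ≠ z ∧
      (runMaps unicycleStep n s ω).conf z = s.conf z := by
  induction n with
  | zero => exact ⟨h0, rfl⟩
  | succ n ih =>
    obtain ⟨h1, h2⟩ := ih (Fin.init ω) fun i => hz _
    refine ⟨hz _, ?_⟩
    simp only [runMaps, unicycleStep_conf]
    rw [Function.update_of_ne h1.symm, h2]

/-- The number of edges of the configuration that point to `v`. -/
def inDegree (v : Fin m) (s : UnicycleState (loopedComplete m)) : ℕ :=
  (Finset.univ.filter fun z => s.conf z = v).card

lemma missed_le_inDegree (v : Fin m) {n : ℕ} (ω : Fin n → Fin m) :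
    missed v ω ≤ inDegree v (runMaps unicycleStep n (starState v) ω) := by
  refine Finset.card_le_card fun z hz => ?_
  simp only [Finset.mem_filter, Finset.mem_univ, true_and] at hz ⊢
  exact (runMaps_unicycleStep_conf_of_not_visited (starState v) ω z hz.1.symm hz.2).2

lemma sum_inDegree (s : UnicycleState (loopedComplete m)) : ∑ v, inDegree v s = m := by
  have := Finset.card_eq_sum_card_fiberwise (f := s.conf) (s := Finset.univ) (t := Finset.univ)
    (by simp)
  simpa [inDegree] using this.symm

/-- The in-degrees of a configuration average to one, so some vertex has mean in-degree at most
one. -/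
lemma exists_mean_inDegree_le_one (hm : 1 ≤ m) {μ : UnicycleState (loopedComplete m) → ℝ}
    (hμ : ∑ s, μ s = 1) : ∃ v : Fin m, ∑ s, μ s * inDegree v s ≤ 1 := by
  have : Nonempty (Fin m) := ⟨⟨0, hm⟩⟩
  have h : ∑ v : Fin m, ∑ s, μ s * (inDegree v s : ℝ) ≤ ∑ _v : Fin m, (1 : ℝ) := by
    rw [Finset.sum_comm]
    simp only [← Finset.mul_sum, ← Nat.cast_sum, sum_inDegree, ← Finset.sum_mul, hμ]
    simp
  obtain ⟨v, -, hv⟩ := Finset.exists_le_of_sum_le Finset.univ_nonempty h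
  exact ⟨v, hv⟩

/-- The lower bound on the distance to stationarity in terms of the mean number `a` of vertices
that the walk started at `v` leaves unvisited: the in-degree of `v` is likely to be at least
`a / 2` when the walk starts from the star at `v`, and unlikely to be so under `μ`. -/
lemma one_sub_le_worstDist (hm : 2 ≤ m) {μ : UnicycleState (loopedComplete m) → ℝ}
    (hμ : IsStationaryDistribution (uniformUnicycleWalk (loopedComplete m)) μ) (n : ℕ) :
    1 - 6 / (((m : ℝ) - 1) * (((m : ℝ) - 1) / m) ^ n) ≤
      worstDist (uniformUnicycleWalk (loopedComplete m)) μ n := by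
  have hm2 : (2 : ℝ) ≤ m := by exact_mod_cast hm
  have hm1 : (0 : ℝ) < m - 1 := by linarith
  obtain ⟨v, hv⟩ := exists_mean_inDegree_le_one (by omega) hμ.2.1
  have : Nonempty (Fin m) := ⟨v⟩
  set a : ℝ := ((m : ℝ) - 1) * (((m : ℝ) - 1) / m) ^ n with ha
  have ha0 : 0 < a := by positivity
  have hrep := isRandomMapRep_uniformUnicycleWalk m
  set P := uniformUnicycleWalk (loopedComplete m) with hP
  refine le_trans ?_ (tvDist_le_worstDist P μ n (starState v))
  classical
  let A := Finset.univ.filter fun u : UnicycleState (loopedComplete m) =>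
    ¬ (inDegree v u : ℝ) < a / 2
  refine le_trans ?_ (sum_sub_sum_le_tvDist (hrep.row_sum n _) hμ.2.1 A)
  have hμA : ∑ s ∈ A, μ s ≤ 2 / a := by
    have h1 : ∑ s ∈ A, μ s * (a / 2) ≤ 1 := by
      refine le_trans ?_ hv
      refine (Finset.sum_le_sum fun s hs => ?_).trans
        (Finset.sum_le_sum_of_subset_of_nonneg (Finset.filter_subset _ _) fun s _ _ =>
          mul_nonneg (hμ.1 s) (Nat.cast_nonneg _))
      exact mul_le_mul_of_nonneg_left (not_lt.1 (Finset.mem_filter.1 hs).2) (hμ.1 s)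
    rw [← Finset.sum_mul] at h1
    rw [le_div_iff₀ ha0]
    linarith
  have hPA : 1 - 4 / a ≤ ∑ s ∈ A, (P ^ n) (starState v) s := by
    have hcompl : ∑ u, (P ^ n) (starState v) u * (if (inDegree v u : ℝ) < a / 2 then 1 else 0) ≤
        4 / a := by
      rw [hrep.sum_pow_mul]
      refine le_trans ?_ (card_missed_lt_le v n (by simpa using hm) (a := a) (by simp [ha]))
      rw [Finset.sum_boole]
      gcongr with ω
      exact missed_le_inDegree v ω
    have hsplit := hrep.row_sum n (starState v)
    rw [← Finset.sum_filter_add_sum_filter_not _ fun u => (inDegree v u : ℝ) < a / 2] at hsplit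
    simp only [mul_ite, mul_one, mul_zero, ← Finset.sum_filter] at hcompl
    simp only [A]
    linarith
  have : 6 / a = 4 / a + 2 / a := by rw [← add_div]; norm_num
  linarith

end Walk

/-! ### Asymptotics of the mixing time -/

section Asymptotics

instance {m : ℕ} [NeZero m] : Nonempty (UnicycleState (loopedComplete m)) :=
  ⟨starState 0⟩

/-- The distance to stationarity at time `n + 1` is at most the expected number of vertices that
`n` uniform draws leave uncollected. -/
lemma worstDist_succ_le {m : ℕ} (hm : 1 ≤ m) {μ : UnicycleState (loopedComplete m) → ℝ}
    (hμ : IsStationaryDistribution (uniformUnicycleWalk (loopedComplete m)) μ) (n : ℕ) :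
    worstDist (uniformUnicycleWalk (loopedComplete m)) μ (n + 1) ≤
      m * ((m - 1) / m : ℝ) ^ n := by
  have : NeZero m := ⟨by omega⟩
  exact ((isRandomMapRep_uniformUnicycleWalk m).worstDist_le (n + 1) (missingWords (Fin m) n)
    (fun ω hω => runMaps_unicycleStep_eq ω hω) hμ).trans (missing_fraction_le hm n)

lemma exists_mul_pow_lt {m : ℕ} (hm : 1 ≤ m) {ε : ℝ} (hε : 0 < ε) :
    ∃ n : ℕ, (m : ℝ) * ((m - 1) / m : ℝ) ^ n < ε := by
  have hm1 : (1 : ℝ) ≤ m := by exact_mod_cast hm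
  have h := (tendsto_pow_atTop_nhds_zero_of_lt_one (r := ((m - 1) / m : ℝ))
    (div_nonneg (by linarith) (by linarith)) (by rw [div_lt_one] <;> linarith)).const_mul (m : ℝ)
  rw [mul_zero] at h
  exact (h.eventually_lt_const hε).exists

lemma existsUnique_isStationaryDistribution {m : ℕ} (hm : 1 ≤ m) :
    ∃! μ : UnicycleState (loopedComplete m) → ℝ,
      IsStationaryDistribution (uniformUnicycleWalk (loopedComplete m)) μ := by
  have : NeZero m := ⟨by omega⟩
  have hrep := isRandomMapRep_uniformUnicycleWalk m
  obtain ⟨μ, hμ⟩ := exists_isStationaryDistribution (uniformUnicycleWalk (loopedComplete m))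
    (fun s u => by simpa using hrep.pow_nonneg 1 s u) (fun s => by simpa using hrep.row_sum 1 s)
  obtain ⟨n, hn⟩ := exists_mul_pow_lt hm one_pos
  exact ⟨μ, hμ, fun ν hν => hrep.isStationaryDistribution_unique (n + 1) (missingWords (Fin m) n)
    (fun ω hω => runMaps_unicycleStep_eq ω hω) ((missing_fraction_le hm n).trans_lt hn) hν hμ⟩

lemma exists_worstDist_lt {m : ℕ} (hm : 1 ≤ m) {μ : UnicycleState (loopedComplete m) → ℝ}
    (hμ : IsStationaryDistribution (uniformUnicycleWalk (loopedComplete m)) μ) {ε : ℝ}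
    (hε : 0 < ε) : ∃ t, worstDist (uniformUnicycleWalk (loopedComplete m)) μ t < ε := by
  obtain ⟨n, hn⟩ := exists_mul_pow_lt hm hε
  exact ⟨n + 1, (worstDist_succ_le hm hμ n).trans_lt hn⟩

lemma tendsto_mul_log_atTop : Tendsto (fun m : ℕ => (m : ℝ) * Real.log m) atTop atTop :=
  tendsto_natCast_atTop_atTop.atTop_mul_atTop₀
    (Real.tendsto_log_atTop.comp tendsto_natCast_atTop_atTop)

variable {μ : (m : ℕ) → UnicycleState (loopedComplete m) → ℝ}

/-- At time about `(1 + δ / 2) m log m` at most `m ^ (-(δ / 2))` vertices are expected to be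
unvisited. -/
lemma eventually_mixingTime_le
    (hμ : ∀ m, 1 ≤ m → IsStationaryDistribution (uniformUnicycleWalk (loopedComplete m)) (μ m))
    {ε δ : ℝ} (hε : 0 < ε) (hδ : 0 < δ) :
    ∀ᶠ m : ℕ in atTop, (mixingTime (uniformUnicycleWalk (loopedComplete m)) (μ m) ε : ℝ) ≤
      (1 + δ) * (m * Real.log m) := by
  have h1 : Tendsto (fun m : ℕ => (m : ℝ) ^ (-(δ / 2))) atTop (𝓝 0) :=
    (tendsto_rpow_neg_atTop (half_pos hδ)).comp tendsto_natCast_atTop_atTop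
  filter_upwards [h1.eventually_lt_const hε, eventually_ge_atTop 1,
    tendsto_mul_log_atTop.eventually_ge_atTop (4 / δ)] with m hlt hm hlog
  have hm0 : (0 : ℝ) < m := by exact_mod_cast hm
  have hm1 : (1 : ℝ) ≤ m := by exact_mod_cast hm
  rw [div_le_iff₀ hδ] at hlog
  have hlog0 : 0 ≤ (m : ℝ) * Real.log m := mul_nonneg hm0.le (Real.log_nonneg hm1)
  -- The slack `δ / 2 * (m * log m) ≥ 2` pays for the rounding and for the extra step.
  set n := ⌈(1 + δ / 2) * (m * Real.log m)⌉₊ with hn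
  have hnle : (1 + δ / 2) * (m * Real.log m) ≤ n := Nat.le_ceil _
  have hnlt : (n : ℝ) < (1 + δ / 2) * (m * Real.log m) + 1 :=
    Nat.ceil_lt_add_one (by positivity)
  have hd : worstDist (uniformUnicycleWalk (loopedComplete m)) (μ m) (n + 1) < ε := by
    refine (worstDist_succ_le hm (hμ m hm) n).trans_lt (lt_of_le_of_lt ?_ hlt)
    have hr : ((m : ℝ) - 1) / m ≤ Real.exp (-(1 / m)) := by
      rw [sub_div, div_self hm0.ne']
      exact Real.one_sub_le_exp_neg _
    calc (m : ℝ) * ((m - 1) / m : ℝ) ^ n ≤ m * Real.exp (-(1 / m)) ^ n := by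
          gcongr
      _ = Real.exp (Real.log m - n / m) := by
          rw [← Real.exp_nat_mul, Real.exp_sub, Real.exp_log hm0, mul_neg, Real.exp_neg,
            mul_one_div]
          exact (div_eq_mul_inv _ _).symm
      _ ≤ Real.exp (Real.log m * -(δ / 2)) := by
          have h2 : (1 + δ / 2) * Real.log m ≤ n / m := by
            rw [le_div_iff₀ hm0]
            linarith
          refine Real.exp_le_exp.2 ?_
          linarith
      _ = (m : ℝ) ^ (-(δ / 2)) := (Real.rpow_def_of_pos hm0 _).symm
  have hle : mixingTime (uniformUnicycleWalk (loopedComplete m)) (μ m) ε ≤ n + 1 := Nat.sInf_le hd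
  have hle' : (mixingTime (uniformUnicycleWalk (loopedComplete m)) (μ m) ε : ℝ) ≤ n + 1 := by
    exact_mod_cast hle
  linarith

/-- Up to time `(1 - δ) m log m` at least `m ^ (δ / 2) / 2` vertices are expected to be
unvisited. -/
lemma eventually_lt_mixingTime
    (hμ : ∀ m, 1 ≤ m → IsStationaryDistribution (uniformUnicycleWalk (loopedComplete m)) (μ m))
    {ε δ : ℝ} (hε : 0 < ε) (hε1 : ε < 1) (hδ : 0 < δ) :
    ∀ᶠ m : ℕ in atTop, (1 - δ) * (m * Real.log m) <
      (mixingTime (uniformUnicycleWalk (loopedComplete m)) (μ m) ε : ℝ) := by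
  have h1 : Tendsto (fun m : ℕ => (m : ℝ) ^ (δ / 2)) atTop atTop :=
    (tendsto_rpow_atTop (half_pos hδ)).comp tendsto_natCast_atTop_atTop
  filter_upwards [h1.eventually_ge_atTop (2 * (6 / (1 - ε))), eventually_ge_atTop 2,
    tendsto_natCast_atTop_atTop.eventually_ge_atTop (2 / δ)] with m hK hm hmδ
  have hm2 : (2 : ℝ) ≤ m := by exact_mod_cast hm
  have hm0 : (0 : ℝ) < m := by linarith
  have hm1 : (0 : ℝ) < m - 1 := by linarith
  by_contra! hcon
  set n := mixingTime (uniformUnicycleWalk (loopedComplete m)) (μ m) ε with hn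
  have hlt : worstDist (uniformUnicycleWalk (loopedComplete m)) (μ m) n < ε :=
    Nat.sInf_mem (exists_worstDist_lt (by omega) (hμ m (by omega)) hε)
  have hlow := one_sub_le_worstDist hm (hμ m (by omega)) n
  set a : ℝ := ((m : ℝ) - 1) * (((m : ℝ) - 1) / m) ^ n with ha
  have hlog : 0 ≤ Real.log m := Real.log_nonneg (by linarith)
  -- This is `1 + x ≤ exp x` at `x = 1 / (m - 1)`, where `1 + x` is the inverse of `(m - 1) / m`.
  have hr : Real.exp (-(1 / (m - 1))) ≤ ((m : ℝ) - 1) / m := by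
    rw [Real.exp_neg, inv_le_comm₀ (Real.exp_pos _) (by positivity), inv_div]
    refine le_trans (le_of_eq ?_) (Real.add_one_le_exp _)
    field_simp
    ring
  -- Trading `δ` for `δ / 2` absorbs the factor `m / (m - 1)`, as `m ≥ 2 / δ`.
  have hexp : n / ((m : ℝ) - 1) ≤ (1 - δ / 2) * Real.log m := by
    rw [div_le_iff₀ hm1]
    rw [div_le_iff₀ hδ] at hmδ
    have : (1 - δ) * m ≤ (1 - δ / 2) * (m - 1) := by nlinarith
    nlinarith [mul_le_mul_of_nonneg_right this hlog]
  have haK : 6 / (1 - ε) ≤ a := by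
    have h2 : (m : ℝ) ^ (δ / 2) / 2 ≤ a := by
      calc (m : ℝ) ^ (δ / 2) / 2
          = m / 2 * Real.exp (-((1 - δ / 2) * Real.log m)) := by
            rw [Real.rpow_def_of_pos hm0,
              show Real.log m * (δ / 2) = Real.log m + -((1 - δ / 2) * Real.log m) by ring,
              Real.exp_add, Real.exp_log hm0]
            ring
        _ ≤ (m - 1) * Real.exp (-(n / ((m : ℝ) - 1))) := by
            gcongr
            linarith
        _ = (m - 1) * Real.exp (-(1 / (m - 1))) ^ n := by
            rw [← Real.exp_nat_mul]
            congr 2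
            ring
        _ ≤ a := by
            rw [ha]
            gcongr
    linarith
  have hε' : 0 < 1 - ε := by linarith
  have ha0 : 0 < a := lt_of_lt_of_le (by positivity) haK
  rw [div_le_iff₀ hε'] at haK
  have : 6 / a ≤ 1 - ε := by
    rw [div_le_iff₀ ha0]
    linarith
  linarith

lemma tendsto_mixingTime_div
    (hμ : ∀ m, 1 ≤ m → IsStationaryDistribution (uniformUnicycleWalk (loopedComplete m)) (μ m))
    {ε : ℝ} (hε : 0 < ε) (hε1 : ε < 1) :
    Tendsto (fun m : ℕ => (mixingTime (uniformUnicycleWalk (loopedComplete m)) (μ m) ε : ℝ) /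
      ((m : ℝ) * Real.log (m : ℝ))) atTop (𝓝 1) := by
  rw [tendsto_order]
  constructor
  · intro b hb
    filter_upwards [eventually_lt_mixingTime hμ hε hε1 (sub_pos.2 hb),
      tendsto_mul_log_atTop.eventually_gt_atTop 0] with m h hpos
    rwa [sub_sub_cancel, ← lt_div_iff₀ hpos] at h
  · intro b hb
    filter_upwards [eventually_mixingTime_le hμ hε (δ := (b - 1) / 2) (by linarith),
      tendsto_mul_log_atTop.eventually_gt_atTop 0] with m h hpos
    rw [div_lt_iff₀ hpos]
    refine lt_of_le_of_lt h ?_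
    gcongr
    linarith

end Asymptotics

theorem mainTheorem1 :
    (∀ m : ℕ, 1 ≤ m →
      ∃! μ : UnicycleState (loopedComplete m) → ℝ,
        IsStationaryDistribution (uniformUnicycleWalk (loopedComplete m)) μ) ∧
    ∀ μ : (m : ℕ) → UnicycleState (loopedComplete m) → ℝ,
      (∀ m : ℕ, 1 ≤ m →
        IsStationaryDistribution (uniformUnicycleWalk (loopedComplete m)) (μ m)) →
      (∀ m : ℕ, 1 ≤ m → ∀ ε : ℝ, 0 < ε →
        ∃ t : ℕ, worstDist (uniformUnicycleWalk (loopedComplete m)) (μ m) t < ε) ∧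
      ∀ ε : ℝ, 0 < ε → ε < 1 →
        Tendsto (fun m : ℕ =>
            (mixingTime (uniformUnicycleWalk (loopedComplete m)) (μ m) ε : ℝ) /
              ((m : ℝ) * Real.log (m : ℝ)))
          atTop (𝓝 1) ∧
        Tendsto (fun m : ℕ =>
            (mixingTime (uniformUnicycleWalk (loopedComplete m)) (μ m) ε : ℝ) /
              (mixingTime (uniformUnicycleWalk (loopedComplete m)) (μ m) (1 - ε) : ℝ))
          atTop (𝓝 1) := by
  refine ⟨fun m hm => existsUnique_isStationaryDistribution hm, fun μ hμ =>
    ⟨fun m hm ε hε => exists_worstDist_lt hm (hμ m hm) hε, fun ε hε hε1 =>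
      ⟨tendsto_mixingTime_div hμ hε hε1, ?_⟩⟩⟩
  have h := (tendsto_mixingTime_div hμ hε hε1).div
    (tendsto_mixingTime_div hμ (ε := 1 - ε) (by linarith) (by linarith)) one_ne_zero
  rw [div_one] at h
  refine h.congr' ?_
  filter_upwards [tendsto_mul_log_atTop.eventually_gt_atTop 0] with m hm
  exact div_div_div_cancel_right₀ hm.ne' _ _
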